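/- Let $P\in\mathbb{Z}[X]$ be a polynomial of degree $d\ge 2$ with leading coefficient $-a_d\neq 0$. For an integer $q\ge 1$, let $G_d(q)\subset \mathbb{Z}/q\mathbb{Z}$ be the set of $d$-th powers modulo $q$ and $G_d^{\times}(q)$ the set of $d$-th powers of invertible residue classes modulo $q$; for $G\subset\mathbb{Z}/q\mathbb{Z}$ put $a_dG=\{a_d g : g\in G\}$, and write $b\in a_dG$ for an integer $b$ whose class modulo $q$ lies in $a_dG$. Let $\omega(q)$ be the number of distinct prime factors of $q$, and let $\lambda$ be Lebesgue measure on $\mathbb{R}$. For $\tau\in\mathbb{R}$ let $I^*_\tau(P)$ be the set of $\alpha\in(0,1)$ for which there are infinitely many pairs of integers $(q,b)$, $q\ge 1$, with $$\left|\alpha-\frac{b}{q^d}\right|<\frac{1}{q^{\tau}}\quad\text{and}\quad b\in a_dG_d(q),$$ and let $\tilde I_\tau(P)$ be the set of $\alpha\in(0,1)$ for which there are infinitely many pairs of integers $(q,b)$, $q\ge1$, with $$\left|\alpha-\frac{b}{q^d}\right|<\frac{1}{q^{\tau}},\quad b\in a_dG_d^{\times}(q)\quad\text{and}\quad \gcd(q,da_d)=1.$$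 1. Let $s\in(0,1]$ and let $m\ge 1$ be an integer. Then for almost every $\alpha\in\mathbb{R}$ there are infinitely many pairs of integers $(q,b)$, $q\ge 1$, such that $$\left|\alpha-\frac{b}{q^d}\right|<\frac{1}{q^{d+s}},\quad b\in a_dG_d^{\times}(q),\quad \gcd(q,da_d)=1\quad\text{and}\quad \omega(q)\le m.$$ 2. In particular, $\lambda(\tilde I_\tau(P))=\lambda(I^*_\tau(P))=1$ for every real $\tau\le d+1$. -/

import Mathlib

open MeasureTheory Polynomial

/-- `G_d(q)`: the set of `d`-th powers modulo `q`. -/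
def powerResidues (d q : ℕ) : Set (ZMod q) :=
  {x | ∃ y : ZMod q, x = y ^ d}

/-- `G_d^×(q)`: the set of primitive `d`-th powers modulo `q`, that is, the `d`-th powers of
invertible residue classes. -/
def primitivePowerResidues (d q : ℕ) : Set (ZMod q) :=
  {x | ∃ y : ZMod q, IsUnit y ∧ x = y ^ d}

/-- `a G = {a m : m ∈ G}` for a set `G` of residue classes modulo `q`. -/
def residueDilate {q : ℕ} (a : ℤ) (G : Set (ZMod q)) : Set (ZMod q) :=
  {x | ∃ m ∈ G, x = (a : ZMod q) * m}

/-- The integer `a_d` such that the leading coefficient of `P` is `-a_d`. -/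
noncomputable def negLeadingCoeff (P : ℤ[X]) : ℤ := -P.leadingCoeff

/-- `I*_τ(P)`: the `α ∈ (0,1)` such that `|α - b / q ^ d| < 1 / q ^ τ` with `b ∈ a_d G_d(q)` for
infinitely many pairs of integers `(q, b)`, `q ≥ 1`, where `d = deg P`. -/
def IStar (P : ℤ[X]) (τ : ℝ) : Set ℝ :=
  {α | α ∈ Set.Ioo (0 : ℝ) 1 ∧
    {p : ℕ × ℤ | 1 ≤ p.1 ∧
      |α - (p.2 : ℝ) / (p.1 : ℝ) ^ P.natDegree| < 1 / (p.1 : ℝ) ^ τ ∧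
      (p.2 : ZMod p.1) ∈
        residueDilate (negLeadingCoeff P) (powerResidues P.natDegree p.1)}.Infinite}

/-- `Ĩ_τ(P)`: the `α ∈ (0,1)` such that `|α - b / q ^ d| < 1 / q ^ τ` with `b ∈ a_d G_d^×(q)` and
`gcd(q, d a_d) = 1` for infinitely many pairs of integers `(q, b)`, `q ≥ 1`, where `d = deg P`. -/
def ITilde (P : ℤ[X]) (τ : ℝ) : Set ℝ :=
  {α | α ∈ Set.Ioo (0 : ℝ) 1 ∧
    {p : ℕ × ℤ | 1 ≤ p.1 ∧
      |α - (p.2 : ℝ) / (p.1 : ℝ) ^ P.natDegree| < 1 / (p.1 : ℝ) ^ τ ∧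
      (p.2 : ZMod p.1) ∈
        residueDilate (negLeadingCoeff P) (primitivePowerResidues P.natDegree p.1) ∧
      Int.gcd (p.1 : ℤ) ((P.natDegree : ℤ) * negLeadingCoeff P) = 1}.Infinite}

/-! Prime denominators suffice. Let `E_p` be the `1/p^(d+1)`-neighbourhood, on the circle, of the
fractions `b/p^d` with `b` in `a_d G_d^×(p)`, for primes `p` not dividing `2 d a_d`.

There are at least `p^d/(2d)` such fractions, so `E_p` has measure at least `1/(2dp)`, and the sum
over primes diverges. The fractions for `p` and `q` are torsion points of coprime orders, so their
differences are distinct `(pq)^d`-torsion points. Few of these lie near `0`, whence `E_p ∩ E_q` has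
measure at most `10/(pq)`. A second-moment Borel–Cantelli argument then makes the limsup set
non-null.

Multiplication by `2^d` permutes `d`-th power classes modulo `p`, so it sends the limsup set into
the one with radii enlarged by `2^d`. Enlarging radii by a constant changes a limsup set only by a
null set, so ergodicity of this map gives full measure. -/

open Filter Topology Metric

/-! ### Divergence Borel–Cantelli -/

/-- A quantitative union bound from pairwise quasi-independence. -/
theorem sub_sq_le_measureReal_biUnion {Ω : Type*} [MeasurableSpace Ω] {μ : Measure Ω}
    [IsFiniteMeasure μ] {E : ℕ → Set Ω} (hE : ∀ i, MeasurableSet (E i)) {a : ℕ → ℝ}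
    (ha : ∀ i, 0 ≤ a i) {c C : ℝ} (hC : 0 ≤ C) (hlow : ∀ i, c * a i ≤ μ.real (E i))
    (hup : ∀ i j, i ≠ j → μ.real (E i ∩ E j) ≤ C * (a i * a j)) (F : Finset ℕ) :
    c * (∑ i ∈ F, a i) - C * (∑ i ∈ F, a i) ^ 2 ≤ μ.real (⋃ i ∈ F, E i) := by
  classical
  induction F using Finset.induction_on with
  | empty => simp
  | insert i F hi ih =>
    rw [Finset.sum_insert hi, Finset.set_biUnion_insert]
    have hU : MeasurableSet (⋃ j ∈ F, E j) := F.measurableSet_biUnion fun j _ => hE j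
    have h1 := measureReal_union_add_inter (μ := μ) (s := E i) hU
      (measure_ne_top _ _) (measure_ne_top _ _)
    have h2 : μ.real (E i ∩ ⋃ j ∈ F, E j) ≤ C * (a i * ∑ j ∈ F, a j) := by
      rw [Set.inter_iUnion₂]
      refine (measureReal_biUnion_finset_le F _).trans ?_
      rw [Finset.mul_sum, Finset.mul_sum]
      exact Finset.sum_le_sum fun j hj => hup i j fun h => hi (h ▸ hj)
    have h3 := hlow i
    have h4 : 0 ≤ ∑ j ∈ F, a j := Finset.sum_nonneg fun j _ => ha j
    -- With `A` the old sum, the square grows by `2 a_i A + a_i ^ 2`, while inclusion–exclusion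
    -- loses only `C a_i A`.
    nlinarith [mul_nonneg hC (mul_nonneg (ha i) h4), mul_nonneg hC (sq_nonneg (a i))]

/-- Sum from an index past which every term is below `δ`, and stop as soon as the total reaches `δ`:
the last term overshoots by less than `δ`. -/
theorem exists_finset_sum_mem_Icc {a : ℕ → ℝ} (ha : ∀ i, 0 ≤ a i)
    (h0 : Tendsto a atTop (𝓝 0)) (hs : ¬ Summable a) {δ : ℝ} (hδ : 0 < δ) (N : ℕ) :
    ∃ F : Finset ℕ, (∀ i ∈ F, N ≤ i) ∧ δ ≤ ∑ i ∈ F, a i ∧ ∑ i ∈ F, a i ≤ 2 * δ := by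
  obtain ⟨M, hM⟩ := eventually_atTop.1 (h0.eventually (gt_mem_nhds hδ))
  set K := max M N
  have hs' : ¬ Summable fun i => a (i + K) := fun h => hs ((summable_nat_add_iff K).1 h)
  have ht := (not_summable_iff_tendsto_nat_atTop_of_nonneg fun i => ha (i + K)).1 hs'
  have hex : ∃ n, δ ≤ ∑ i ∈ Finset.range n, a (i + K) := (ht.eventually_ge_atTop δ).exists
  classical
  have hn := Nat.find_spec hex
  have hmin := fun m => Nat.find_min (m := m) hex
  set n := Nat.find hex
  refine ⟨(Finset.range n).map (addRightEmbedding K), ?_, ?_, ?_⟩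
  · intro i hi
    simp only [Finset.mem_map, addRightEmbedding_apply] at hi
    obtain ⟨j, -, rfl⟩ := hi
    exact (le_max_right M N).trans (Nat.le_add_left _ _)
  · simpa using hn
  · rcases hn0 : n with _ | k
    · simp [hδ.le]
    · have h1 := hmin k (by omega)
      have h2 := hM (k + K) ((le_max_left M N).trans (Nat.le_add_left _ _))
      simp only [Finset.sum_map, addRightEmbedding_apply, Finset.sum_range_succ]
      linarith

/-- A divergence Borel–Cantelli lemma for pairwise quasi-independent events. -/
theorem measure_frequently_mem_ne_zero {Ω : Type*} [MeasurableSpace Ω] {μ : Measure Ω}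
    [IsFiniteMeasure μ] {E : ℕ → Set Ω} (hE : ∀ i, MeasurableSet (E i)) {a : ℕ → ℝ}
    (ha : ∀ i, 0 ≤ a i) (h0 : Tendsto a atTop (𝓝 0)) (hs : ¬ Summable a)
    {c C : ℝ} (hc : 0 < c) (hC : 0 < C) (hlow : ∀ i, c * a i ≤ μ.real (E i))
    (hup : ∀ i j, i ≠ j → μ.real (E i ∩ E j) ≤ C * (a i * a j)) :
    μ {x | ∃ᶠ i in atTop, x ∈ E i} ≠ 0 := by
  set U : ℕ → Set Ω := fun N => ⋃ i ≥ N, E i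
  have hUm : ∀ N, MeasurableSet (U N) := fun N =>
    MeasurableSet.iUnion fun i => MeasurableSet.iUnion fun _ => hE i
  have hset : {x | ∃ᶠ i in atTop, x ∈ E i} = ⋂ N, U N := by
    ext x
    simp [U, frequently_atTop]
  -- For `A` between `c/(4C)` and `c/(2C)`, `A * (c - C * A)` is at least `c ^ 2 / (8C)`, uniformly
  -- in the tail.
  have hδ : 0 < c / (4 * C) := by positivity
  have hbound : ∀ N, c ^ 2 / (8 * C) ≤ μ.real (U N) := by
    intro N
    obtain ⟨F, hFN, h1, h2⟩ := exists_finset_sum_mem_Icc ha h0 hs hδ N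
    have h3 := sub_sq_le_measureReal_biUnion hE ha hC.le hlow hup F
    have h4 : μ.real (⋃ i ∈ F, E i) ≤ μ.real (U N) := by
      refine measureReal_mono ?_ (measure_ne_top _ _)
      exact Set.iUnion₂_subset fun i hi => Set.subset_biUnion_of_mem (u := E) (hFN i hi)
    refine le_trans ?_ (h3.trans h4)
    set A := ∑ i ∈ F, a i
    have h5 : C * A ≤ c / 2 := by
      calc C * A ≤ C * (2 * (c / (4 * C))) := by gcongr
        _ = c / 2 := by field_simp; ring
    have h6 : c ^ 2 / (8 * C) = (c / (4 * C)) * (c / 2) := by field_simp; ring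
    rw [h6]
    calc (c / (4 * C)) * (c / 2) ≤ A * (c - C * A) :=
          mul_le_mul h1 (by linarith) (by positivity) (hδ.le.trans h1)
      _ = _ := by ring
  have hanti : Antitone U := fun M N h =>
    Set.iUnion₂_subset fun i hi => Set.subset_biUnion_of_mem (u := E) (le_trans h hi)
  have hlim := tendsto_measure_iInter_atTop (μ := μ) (fun N => (hUm N).nullMeasurableSet) hanti
    ⟨0, measure_ne_top _ _⟩
  rw [hset]
  intro hzero
  rw [hzero] at hlim
  have hlim' : Tendsto (fun N => μ.real (U N)) atTop (𝓝 0) := by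
    exact (ENNReal.tendsto_toReal ENNReal.zero_ne_top).comp hlim
  have := ge_of_tendsto' hlim' hbound
  have : 0 < c ^ 2 / (8 * C) := by positivity
  linarith

/-! ### Torsion points of the circle and their neighbourhoods -/

namespace UnitAddCircle

theorem coe_intCast (n : ℤ) : ((n : ℝ) : UnitAddCircle) = 0 :=
  (AddCircle.coe_eq_zero_iff 1).2 ⟨n, by simp⟩

theorem exists_coe_eq_abs_eq_norm (z : UnitAddCircle) : ∃ t : ℝ, (t : UnitAddCircle) = z ∧
    |t| = ‖z‖ := by
  induction z using QuotientAddGroup.induction_on with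
  | H x =>
    refine ⟨x - round x, ?_, (UnitAddCircle.norm_eq).symm⟩
    rw [AddCircle.coe_sub, coe_intCast, sub_zero]

theorem exists_int_of_nsmul_eq_zero {N : ℕ} {t : ℝ} (h : N • (t : UnitAddCircle) = 0) :
    ∃ n : ℤ, (n : ℝ) = N * t := by
  rw [← AddCircle.coe_nsmul, AddCircle.coe_eq_zero_iff] at h
  obtain ⟨n, hn⟩ := h
  exact ⟨n, by simpa using hn⟩

theorem torsion_ball_finite_ncard_le {N : ℕ} (hN : 0 < N) {ρ : ℝ} (hρ : 0 ≤ ρ) :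
    {z : UnitAddCircle | N • z = 0 ∧ ‖z‖ < ρ}.Finite ∧
      ({z : UnitAddCircle | N • z = 0 ∧ ‖z‖ < ρ}.ncard : ℝ) ≤ 2 * (N * ρ) + 1 := by
  have hN' : (0 : ℝ) < N := by exact_mod_cast hN
  set k : ℤ := ⌊N * ρ⌋
  have hk : 0 ≤ k := Int.floor_nonneg.2 (by positivity)
  classical
  set T : Finset UnitAddCircle :=
    (Finset.Icc (-k) k).image fun n : ℤ => (((n : ℝ) / N : ℝ) : UnitAddCircle)
  have hsub : {z : UnitAddCircle | N • z = 0 ∧ ‖z‖ < ρ} ⊆ T := by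
    rintro z ⟨hz, hzρ⟩
    obtain ⟨t, rfl, ht⟩ := exists_coe_eq_abs_eq_norm z
    obtain ⟨n, hn⟩ := exists_int_of_nsmul_eq_zero hz
    have h1 : |(n : ℝ)| ≤ N * ρ := by
      rw [hn, abs_mul, Nat.abs_cast, ht]
      gcongr
    have h2 : |n| ≤ k := Int.le_floor.2 (by simpa using h1)
    simp only [T, Finset.coe_image, Set.mem_image, Finset.mem_coe, Finset.mem_Icc]
    refine ⟨n, abs_le.1 h2, ?_⟩
    rw [hn, mul_div_cancel_left₀ _ hN'.ne']
  refine ⟨T.finite_toSet.subset hsub, ?_⟩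
  have h1 := Set.ncard_le_ncard hsub T.finite_toSet
  rw [Set.ncard_coe_finset] at h1
  have h2 : T.card ≤ (k + 1 - -k).toNat := Finset.card_image_le.trans (by simp)
  have h3 : ((k + 1 - -k).toNat : ℝ) = 2 * k + 1 := by
    have : ((k + 1 - -k).toNat : ℤ) = 2 * k + 1 := by omega
    exact_mod_cast this
  have h4 : (k : ℝ) ≤ N * ρ := Int.floor_le _
  calc _ ≤ (((k + 1 - -k).toNat : ℕ) : ℝ) := by exact_mod_cast h1.trans h2
    _ ≤ _ := by linarith

theorem one_div_le_norm_of_nsmul_eq_zero {N : ℕ} (hN : 0 < N) {z : UnitAddCircle}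
    (h : N • z = 0) (hz : z ≠ 0) : 1 / (N : ℝ) ≤ ‖z‖ := by
  obtain ⟨t, rfl, ht⟩ := exists_coe_eq_abs_eq_norm z
  obtain ⟨n, hn⟩ := exists_int_of_nsmul_eq_zero h
  have hN' : (0 : ℝ) < N := by exact_mod_cast hN
  have hn0 : n ≠ 0 := by
    rintro rfl
    have : t = 0 := by
      rcases mul_eq_zero.1 (hn.symm.trans Int.cast_zero) with h | h
      · exact absurd h hN'.ne'
      · exact h
    exact hz (by simp [this])
  have h1 : (1 : ℝ) ≤ |(n : ℝ)| := by exact_mod_cast Int.one_le_abs hn0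
  rw [← ht, div_le_iff₀ hN', mul_comm]
  rwa [hn, abs_mul, Nat.abs_cast] at h1

theorem torsion_finite {N : ℕ} (hN : 0 < N) : {z : UnitAddCircle | N • z = 0}.Finite := by
  refine (torsion_ball_finite_ncard_le hN zero_le_one).1.subset fun z hz => ⟨hz, ?_⟩
  have := AddCircle.norm_le_half_period (1 : ℝ) (x := z) one_ne_zero
  rw [abs_one] at this
  linarith

/-- The points near two torsion sets of coprime exponents occupy little space. -/
theorem volume_thickening_inter_thickening_le {N M : ℕ} (hN : 0 < N) (hM : 0 < M)
    (hNM : N.Coprime M) {S T : Set UnitAddCircle} (hS : ∀ x ∈ S, N • x = 0)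
    (hT : ∀ x ∈ T, M • x = 0) {r ρ : ℝ} (hρ : 0 < ρ) (hρr : ρ ≤ r) :
    volume.real (thickening r S ∩ thickening ρ T) ≤ (4 * (N * M * r) + 1) * (2 * ρ) := by
  set W : Set (UnitAddCircle × UnitAddCircle) :=
    {w | w.1 ∈ S ∧ w.2 ∈ T ∧ ‖w.1 - w.2‖ < 2 * r}
  set Z := {z : UnitAddCircle | (N * M) • z = 0 ∧ ‖z‖ < 2 * r}
  have hr : 0 < r := hρ.trans_le hρr
  obtain ⟨hZf, hZc⟩ := torsion_ball_finite_ncard_le (mul_pos hN hM) (ρ := 2 * r) (by positivity)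
  have hmaps : ∀ w ∈ W, w.1 - w.2 ∈ Z := by
    rintro ⟨x, y⟩ ⟨hx, hy, hxy⟩
    refine ⟨?_, hxy⟩
    change (N * M) • (x - y) = 0
    rw [smul_sub, mul_smul N M y, hT y hy, mul_comm N M, mul_smul M N x, hS x hx]
    simp
  -- If two pairs have the same difference, then `x - x' = y - y'` is killed by both `N` and `M`,
  -- hence is zero.
  have hinj : Set.InjOn (fun w : UnitAddCircle × UnitAddCircle => w.1 - w.2) W := by
    rintro ⟨x, y⟩ ⟨hx, hy, -⟩ ⟨x', y'⟩ ⟨hx', hy', -⟩ h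
    simp only at h hx hy hx' hy'
    have hd : x - x' = y - y' := by
      rw [sub_eq_sub_iff_add_eq_add] at h ⊢
      rw [h]; abel
    have h1 : N • (x - x') = 0 := by rw [smul_sub, hS x hx, hS x' hx', sub_zero]
    have h2 : M • (x - x') = 0 := by rw [hd, smul_sub, hT y hy, hT y' hy', sub_zero]
    have h3 : x - x' = 0 := by
      rw [← AddMonoid.addOrderOf_eq_one_iff]
      exact Nat.eq_one_of_dvd_coprimes hNM (addOrderOf_dvd_of_nsmul_eq_zero h1)
        (addOrderOf_dvd_of_nsmul_eq_zero h2)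
    rw [Prod.mk.injEq]
    exact ⟨sub_eq_zero.1 h3, sub_eq_zero.1 (hd ▸ h3)⟩
  have hWf : W.Finite := Set.Finite.of_finite_image (hZf.subset (Set.image_subset_iff.2 hmaps)) hinj
  have hWc : W.ncard ≤ Z.ncard := Set.ncard_le_ncard_of_injOn _ hmaps hinj hZf
  -- Balls of the smaller radius `ρ` about the second coordinates suffice; `r` enters only through
  -- the number of pairs.
  have hcover : thickening r S ∩ thickening ρ T ⊆ ⋃ w ∈ hWf.toFinset, closedBall w.2 ρ := by
    rintro z ⟨h1, h2⟩
    obtain ⟨x, hx, hzx⟩ := mem_thickening_iff.1 h1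
    obtain ⟨y, hy, hzy⟩ := mem_thickening_iff.1 h2
    refine Set.mem_biUnion (x := (x, y)) ?_ hzy.le
    simp only [Finset.mem_coe, Set.Finite.mem_toFinset]
    refine ⟨hx, hy, ?_⟩
    rw [← dist_eq_norm]
    linarith [dist_triangle_left x y z]
  have hball : ∀ x : UnitAddCircle, volume.real (closedBall x ρ) ≤ 2 * ρ := by
    intro x
    rw [measureReal_def, AddCircle.volume_closedBall]
    rw [ENNReal.toReal_ofReal (by positivity)]
    exact min_le_right _ _
  calc volume.real (thickening r S ∩ thickening ρ T)
      ≤ volume.real (⋃ w ∈ hWf.toFinset, closedBall w.2 ρ) := measureReal_mono hcover (measure_ne_top _ _)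
    _ ≤ ∑ w ∈ hWf.toFinset, volume.real (closedBall w.2 ρ) := measureReal_biUnion_finset_le _ _
    _ ≤ ∑ w ∈ hWf.toFinset, 2 * ρ := Finset.sum_le_sum fun w _ => hball _
    _ = W.ncard * (2 * ρ) := by
      rw [Finset.sum_const, nsmul_eq_mul, Set.ncard_eq_toFinset_card W hWf]
    _ ≤ (4 * (N * M * r) + 1) * (2 * ρ) := by
      gcongr
      refine (Nat.cast_le.2 hWc).trans (hZc.trans_eq ?_)
      push_cast
      ring

/-- Distinct `N`-torsion points are at least `1/N > r` apart, so the balls of radius `r/2`, each of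
measure `r`, are disjoint. -/
theorem ncard_mul_le_volume_thickening {N : ℕ} (hN : 0 < N) {S : Set UnitAddCircle}
    (hS : ∀ x ∈ S, N • x = 0) {r : ℝ} (hr : 0 < r) (hrN : r < 1 / N) :
    S.ncard * r ≤ volume.real (thickening r S) := by
  have hN' : (1 : ℝ) ≤ N := by exact_mod_cast hN
  have hr1 : r ≤ 1 := hrN.le.trans ((div_le_one (by positivity)).2 hN')
  have hSf : S.Finite := (torsion_finite hN).subset hS
  have hball : ∀ x : UnitAddCircle, volume.real (closedBall x (r / 2)) = r := by
    intro x
    rw [measureReal_def, AddCircle.volume_closedBall, ENNReal.toReal_ofReal (by positivity)]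
    rw [mul_div_cancel₀ r two_ne_zero, min_eq_right hr1]
  have hdisj : (hSf.toFinset : Set UnitAddCircle).PairwiseDisjoint
      fun x => closedBall x (r / 2) := by
    intro x hx y hy hxy
    simp only [Finset.mem_coe, Set.Finite.mem_toFinset] at hx hy
    refine closedBall_disjoint_closedBall ?_
    rw [dist_eq_norm]
    have h1 : N • (x - y) = 0 := by rw [smul_sub, hS x hx, hS y hy, sub_zero]
    have := one_div_le_norm_of_nsmul_eq_zero hN h1 (sub_ne_zero.2 hxy)
    linarith
  calc S.ncard * r = ∑ x ∈ hSf.toFinset, volume.real (closedBall x (r / 2)) := by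
        rw [Finset.sum_congr rfl fun x _ => hball x, Finset.sum_const, nsmul_eq_mul,
          Set.ncard_eq_toFinset_card S hSf]
    _ = volume.real (⋃ x ∈ hSf.toFinset, closedBall x (r / 2)) :=
        (measureReal_biUnion_finset hdisj fun x _ => isClosed_closedBall.measurableSet).symm
    _ ≤ _ := by
      refine measureReal_mono (Set.iUnion₂_subset fun x hx z hz => ?_)
      refine mem_thickening_iff.2 ⟨x, hSf.mem_toFinset.1 hx, ?_⟩
      have : dist z x ≤ r / 2 := hz
      linarith

/-- A property of the circle holding almost everywhere holds almost everywhere on the line. -/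
theorem ae_coe_of_ae {p : UnitAddCircle → Prop} (h : ∀ᵐ x, p x) :
    ∀ᵐ α : ℝ, p (α : UnitAddCircle) := by
  have hn : ∀ n : ℤ, ∀ᵐ α : ℝ ∂(volume.restrict (Set.Ioc (n : ℝ) (n + 1))),
      p (α : UnitAddCircle) := fun n =>
    (UnitAddCircle.measurePreserving_mk (n : ℝ)).quasiMeasurePreserving.ae h
  have := (ae_restrict_iUnion_iff (μ := (volume : Measure ℝ))
    (fun n : ℤ => Set.Ioc (n : ℝ) (n + 1)) fun α => p (α : UnitAddCircle)).2 hn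
  rwa [iUnion_Ioc_intCast, Measure.restrict_univ] at this

end UnitAddCircle

/-! ### Measure and overlap of neighbourhoods of power fractions -/

/-- The fractions `b / q ^ d` modulo one with `b` in the dilate by `a` of the primitive `d`-th power
residues modulo `q`. -/
def primitivePowerFractions (d : ℕ) (a : ℤ) (q : ℕ) : Set UnitAddCircle :=
  {x | ∃ b : ℤ, (b : ZMod q) ∈ residueDilate a (primitivePowerResidues d q) ∧
    (((b : ℝ) / (q : ℝ) ^ d : ℝ) : UnitAddCircle) = x}

namespace primitivePowerFractions

theorem nsmul_eq_zero {d : ℕ} {a : ℤ} {q : ℕ} (hq : 0 < q) {x : UnitAddCircle}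
    (hx : x ∈ primitivePowerFractions d a q) : q ^ d • x = 0 := by
  obtain ⟨b, -, rfl⟩ := hx
  have hq' : (q : ℝ) ^ d ≠ 0 := by positivity
  rw [← AddCircle.coe_nsmul, nsmul_eq_mul, Nat.cast_pow, mul_div_cancel₀ _ hq',
    UnitAddCircle.coe_intCast]

theorem pow_nsmul_mem {d : ℕ} {a : ℤ} {q k : ℕ} (hk : k.Coprime q) {x : UnitAddCircle}
    (hx : x ∈ primitivePowerFractions d a q) : k ^ d • x ∈ primitivePowerFractions d a q := by
  obtain ⟨b, ⟨-, ⟨y, hy, rfl⟩, hb⟩, rfl⟩ := hx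
  refine ⟨k ^ d * b, ⟨(k * y) ^ d, ⟨k * y, ?_, rfl⟩, ?_⟩, ?_⟩
  · exact ((ZMod.isUnit_iff_coprime k q).2 hk).mul hy
  · push_cast
    rw [hb]
    ring
  · rw [← AddCircle.coe_nsmul, nsmul_eq_mul]
    push_cast
    rw [mul_div_assoc]

/-- Each fibre of `y ↦ a * y ^ d` consists of `d`-th roots of a fixed element, so it has at most `d`
points. -/
theorem card_units_le_mul_card {d p : ℕ} (hd : 0 < d) [Fact p.Prime] {a : ZMod p} (ha : a ≠ 0) :
    p - 1 ≤ d * ((Finset.univ.erase (0 : ZMod p)).image fun y => a * y ^ d).card := by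
  classical
  have h := Finset.card_le_mul_card_image (f := fun y : ZMod p => a * y ^ d)
    (Finset.univ.erase (0 : ZMod p)) d fun b _ => ?_
  · rwa [Finset.card_erase_of_mem (Finset.mem_univ _), Finset.card_univ, ZMod.card] at h
  · refine (Finset.card_le_card (t := (nthRoots d (b / a)).toFinset) fun y hy => ?_).trans
      ((Multiset.toFinset_card_le _).trans (card_nthRoots d _))
    rw [Multiset.mem_toFinset, mem_nthRoots hd, ← (Finset.mem_filter.1 hy).2,
      mul_div_cancel_left₀ _ ha]

/-- At least `(p-1)/d` residues occur modulo `p`, each with `p^(d-1)` lifts modulo `p^d`; the factor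
2 comes from `p ≤ 2(p-1)`. -/
theorem pow_le_mul_ncard {d p : ℕ} (hd : 0 < d) (hp : p.Prime) {a : ℤ}
    (ha : (a : ZMod p) ≠ 0) : p ^ d ≤ 2 * d * (primitivePowerFractions d a p).ncard := by
  classical
  have : Fact p.Prime := ⟨hp⟩
  obtain ⟨e, rfl⟩ : ∃ e, d = e + 1 := ⟨d - 1, by omega⟩
  set R := (Finset.univ.erase (0 : ZMod p)).image fun y => (a : ZMod p) * y ^ (e + 1)
  have hR := card_units_le_mul_card hd ha
  set f : ZMod p × ℕ → UnitAddCircle := fun w =>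
    ((((w.1.val + p * w.2 : ℕ) : ℝ) / (p : ℝ) ^ (e + 1) : ℝ) : UnitAddCircle)
  have hpos : (0 : ℝ) < (p : ℝ) ^ (e + 1) := by
    have := hp.pos
    positivity
  have hfin : (primitivePowerFractions (e + 1) a p).Finite :=
    (UnitAddCircle.torsion_finite (pow_pos hp.pos (e + 1))).subset
      fun x hx => nsmul_eq_zero hp.pos hx
  have hlt : ∀ w ∈ R ×ˢ Finset.range (p ^ e), w.1.val + p * w.2 < p ^ (e + 1) := by
    intro w hw
    have h1 : w.2 + 1 ≤ p ^ e := Finset.mem_range.1 (Finset.mem_product.1 hw).2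
    have h2 := ZMod.val_lt w.1
    calc w.1.val + p * w.2 < p * (w.2 + 1) := by rw [mul_add]; omega
      _ ≤ p * p ^ e := Nat.mul_le_mul_left _ h1
      _ = p ^ (e + 1) := (pow_succ' p e).symm
  have hIco : ∀ w ∈ R ×ˢ Finset.range (p ^ e),
      ((w.1.val + p * w.2 : ℕ) : ℝ) / (p : ℝ) ^ (e + 1) ∈ Set.Ico (0 : ℝ) (0 + 1) := by
    intro w hw
    refine ⟨by positivity, ?_⟩
    rw [zero_add, div_lt_one hpos]
    exact_mod_cast hlt w hw
  have hcard : (R ×ˢ Finset.range (p ^ e)).card ≤ (primitivePowerFractions (e + 1) a p).ncard := by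
    rw [← Set.ncard_coe_finset]
    refine Set.ncard_le_ncard_of_injOn f ?_ ?_ hfin
    · intro w hw
      obtain ⟨y, hy, hyw⟩ := Finset.mem_image.1 (Finset.mem_product.1 hw).1
      refine ⟨(w.1.val + p * w.2 : ℕ), ⟨y ^ (e + 1), ⟨y, ?_, rfl⟩, ?_⟩, ?_⟩
      · exact (Finset.ne_of_mem_erase hy).isUnit
      · rw [hyw]
        simp
      · simp [f]
    · intro w hw v hv h
      have h1 := (AddCircle.coe_eq_coe_iff_of_mem_Ico (hIco w hw) (hIco v hv)).1 h
      rw [div_left_inj' hpos.ne', Nat.cast_inj] at h1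
      have h2 : w.1.val = v.1.val := by
        have := congrArg (· % p) h1
        simpa [Nat.add_mul_mod_self_left, Nat.mod_eq_of_lt (ZMod.val_lt _)] using this
      rw [h2, Nat.add_left_cancel_iff] at h1
      exact Prod.ext (ZMod.val_injective p h2) (Nat.eq_of_mul_eq_mul_left hp.pos h1)
  rw [Finset.card_product, Finset.card_range] at hcard
  have hp2 : p ≤ 2 * (p - 1) := by have := hp.two_le; omega
  calc p ^ (e + 1) = p * p ^ e := pow_succ' p e
    _ ≤ 2 * ((e + 1) * R.card) * p ^ e :=
      Nat.mul_le_mul_right _ (hp2.trans (Nat.mul_le_mul_left 2 hR))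
    _ = 2 * (e + 1) * (R.card * p ^ e) := by ring
    _ ≤ _ := Nat.mul_le_mul_left _ hcard

theorem one_div_le_volume_thickening {d p : ℕ} (hd : 0 < d) (hp : p.Prime) {a : ℤ}
    (ha : (a : ZMod p) ≠ 0) : 1 / (2 * d : ℝ) * (1 / p) ≤
      volume.real (thickening (1 / (p : ℝ) ^ (d + 1)) (primitivePowerFractions d a p)) := by
  have hp1 : (1 : ℝ) < p := by exact_mod_cast hp.one_lt
  have hp0 : (0 : ℝ) < p := by positivity
  have hd0 : (0 : ℝ) < d := by exact_mod_cast hd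
  refine le_trans ?_ (UnitAddCircle.ncard_mul_le_volume_thickening (pow_pos hp.pos d)
    (fun x hx => nsmul_eq_zero hp.pos hx) (by positivity) ?_)
  · have h : (p : ℝ) ^ d ≤ 2 * d * (primitivePowerFractions d a p).ncard := by
      exact_mod_cast pow_le_mul_ncard hd hp ha
    calc 1 / (2 * d : ℝ) * (1 / p) = ((p : ℝ) ^ d / (2 * d)) * (1 / (p : ℝ) ^ (d + 1)) := by
          field_simp
          ring
      _ ≤ _ := by
        gcongr
        rw [div_le_iff₀ (by positivity)]
        linarith
  · push_cast
    exact one_div_lt_one_div_of_lt (by positivity) (pow_lt_pow_right₀ hp1 (Nat.lt_succ_self d))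

theorem volume_inter_le {d p q : ℕ} (hd : 0 < d) (hp : p.Prime) (hq : q.Prime) (hpq : p < q)
    (a : ℤ) :
    volume.real (thickening (1 / (p : ℝ) ^ (d + 1)) (primitivePowerFractions d a p) ∩
      thickening (1 / (q : ℝ) ^ (d + 1)) (primitivePowerFractions d a q)) ≤
        10 * (1 / (p : ℝ) * (1 / q)) := by
  have hp0 : (0 : ℝ) < p := by exact_mod_cast hp.pos
  have hq0 : (0 : ℝ) < q := by exact_mod_cast hq.pos
  have hq1 : (1 : ℝ) ≤ q := by exact_mod_cast hq.one_le
  have hpq' : (p : ℝ) ≤ q := by exact_mod_cast hpq.le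
  have hcop : (p ^ d).Coprime (q ^ d) :=
    Nat.Coprime.pow d d ((Nat.coprime_primes hp hq).2 hpq.ne)
  refine (UnitAddCircle.volume_thickening_inter_thickening_le (pow_pos hp.pos d)
    (pow_pos hq.pos d) hcop (fun x hx => nsmul_eq_zero hp.pos hx)
    (fun x hx => nsmul_eq_zero hq.pos hx) (by positivity) ?_).trans ?_
  · gcongr
  -- Here `N M r = q^d/p ≥ 1`, so the additive `1` in the pair count is absorbed: `4 + 1 = 5`, and
  -- the ball measure `2ρ` makes it `10`.
  · have h1 : 1 ≤ (q : ℝ) ^ d / p := by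
      rw [one_le_div hp0]
      exact hpq'.trans (le_self_pow₀ hq1 hd.ne')
    calc _ = (4 * ((q : ℝ) ^ d / p) + 1) * (2 * (1 / (q : ℝ) ^ (d + 1))) := by
          push_cast
          field_simp
          ring
      _ ≤ (5 * ((q : ℝ) ^ d / p)) * (2 * (1 / (q : ℝ) ^ (d + 1))) := by
          gcongr
          linarith
      _ = _ := by
          field_simp
          ring

end primitivePowerFractions

/-! ### Divergence over primes and the zero-one law -/

theorem not_summable_one_div_primes_not_dvd {K : ℕ} (hK : K ≠ 0) :
    ¬ Summable ({p : ℕ | p.Prime ∧ ¬ p ∣ K}.indicator fun n : ℕ => (1 / n : ℝ)) := by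
  intro h
  refine not_summable_one_div_on_primes (h.congr_cofinite ?_)
  have hfin : {p : ℕ | p ∣ K}.Finite := (Nat.divisors K).finite_toSet.subset fun p hp => by
    simpa [hK] using hp
  filter_upwards [hfin.compl_mem_cofinite] with p hp
  have hp' : ¬ p ∣ K := hp
  by_cases h : p.Prime <;> simp [Set.indicator, h, hp']

/-- Almost every point of the circle is well approximated by primitive power fractions with prime
denominators coprime to a given integer. -/
theorem ae_frequently_mem_thickening_primitivePowerFractions {d : ℕ} (hd : 0 < d) (a : ℤ) {K : ℕ}
    (hK : K ≠ 0) (h2K : 2 ∣ K) (haK : a ∣ K) :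
    ∀ᵐ x : UnitAddCircle, ∃ᶠ p : ℕ in atTop, (p.Prime ∧ ¬ p ∣ K) ∧
      x ∈ thickening (1 / (p : ℝ) ^ (d + 1)) (primitivePowerFractions d a p) := by
  classical
  set Q : ℕ → Prop := fun p => p.Prime ∧ ¬ p ∣ K with hQ
  set r : ℕ → ℝ := fun p => 1 / (p : ℝ) ^ (d + 1) with hr
  set S : ℕ → Set UnitAddCircle := primitivePowerFractions d a
  have hr0 : Tendsto r atTop (𝓝 0) := by
    have := (tendsto_pow_atTop (α := ℝ) (n := d + 1) (by omega)).comp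
      (tendsto_natCast_atTop_atTop (R := ℝ))
    simp only [hr, one_div]
    exact this.inv_tendsto_atTop
  have hmem : ∀ ρ : ℕ → ℝ, blimsup (fun p => thickening (ρ p) (S p)) atTop Q =
      {x | ∃ᶠ p : ℕ in atTop, Q p ∧ x ∈ thickening (ρ p) (S p)} := by
    intro ρ
    rw [← Nat.cofinite_eq_atTop, cofinite.blimsup_set_eq]
    ext x
    simp only [Set.mem_ofPred_eq, frequently_cofinite_iff_infinite]
  set B : Set UnitAddCircle := blimsup (fun p => thickening (r p) (S p)) atTop Q with hB
  have hBm : MeasurableSet B :=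
    MeasurableSet.measurableSet_blimsup fun n _ => isOpen_thickening.measurableSet
  have hpos : volume B ≠ 0 := by
    -- Indices outside `Q` get empty events and zero weights, so both bounds are trivial there.
    have := measure_frequently_mem_ne_zero (μ := (volume : Measure UnitAddCircle))
      (E := fun p => {x | Q p ∧ x ∈ thickening (r p) (S p)})
      (a := {p | Q p}.indicator fun n : ℕ => (1 / n : ℝ)) (c := 1 / (2 * d)) (C := 10)
      (fun p => (MeasurableSet.const _).inter isOpen_thickening.measurableSet)
      (fun p => Set.indicator_nonneg (fun n _ => by positivity) p) ?_
      (not_summable_one_div_primes_not_dvd hK) (by positivity) (by norm_num) ?_ ?_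
    · rwa [hB, hmem r]
    · refine squeeze_zero (fun p => Set.indicator_nonneg (fun n _ => by positivity) p)
        (fun p => Set.indicator_le_self' (fun n _ => by positivity) p)
        tendsto_one_div_atTop_nhds_zero_nat
    · intro p
      by_cases hp : Q p
      · simp only [Set.indicator, Set.mem_ofPred_eq, hp, if_true, true_and]
        refine primitivePowerFractions.one_div_le_volume_thickening hd hp.1 fun h => hp.2 ?_
        rw [ZMod.intCast_zmod_eq_zero_iff_dvd] at h
        exact_mod_cast h.trans haK
      · simp [Set.indicator, hp]
    · intro p q hpq
      by_cases hp : Q p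
      · by_cases hq : Q q
        · simp only [Set.indicator, Set.mem_ofPred_eq, hp, hq, if_true, true_and]
          rcases hpq.lt_or_gt with h | h
          · exact primitivePowerFractions.volume_inter_le hd hp.1 hq.1 h a
          · rw [Set.inter_comm, mul_comm (1 / (p : ℝ))]
            exact primitivePowerFractions.volume_inter_le hd hq.1 hp.1 h a
        · simp [Set.indicator, hq]
      · simp [Set.indicator, hp]
  have h2d : 1 < 2 ^ d := Nat.one_lt_two_pow hd.ne'
  have himage : (fun x : UnitAddCircle => 2 ^ d • x) '' B ⊆
      blimsup (fun p => thickening (((2 ^ d : ℕ) : ℝ) * r p) (S p)) atTop Q := by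
    rw [hB, hmem r, hmem]
    rintro _ ⟨x, hx, rfl⟩
    refine hx.mono fun p hp => ⟨hp.1, ?_⟩
    obtain ⟨y, hy, hxy⟩ := mem_thickening_iff.1 hp.2
    have hcop : Nat.Coprime 2 p := by
      rw [Nat.coprime_primes Nat.prime_two hp.1.1]
      rintro rfl
      exact hp.1.2 h2K
    refine mem_thickening_iff.2 ⟨2 ^ d • y, primitivePowerFractions.pow_nsmul_mem hcop hy, ?_⟩
    rw [dist_eq_norm, ← smul_sub]
    refine (norm_nsmul_le).trans_lt ?_
    rw [← dist_eq_norm]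
    gcongr
  -- Cassels' lemma: scaling all radii by a fixed positive constant leaves the limsup set unchanged
  -- up to a null set.
  have hinv : (fun x : UnitAddCircle => 2 ^ d • x) '' B ≤ᵐ[volume] B :=
    (LE.le.eventuallyLE himage).congr EventuallyEq.rfl
      (blimsup_thickening_mul_ae_eq volume Q S (by positivity) r hr0)
  rcases (AddCircle.ergodic_nsmul h2d).ae_empty_or_univ_of_image_ae_le
    hBm.nullMeasurableSet hinv with h | h
  · exact absurd (ae_eq_empty.1 h) hpos
  · have h' := eventuallyEq_univ.1 h
    rw [hB, hmem r] at h'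
    exact h'

/-! ### Transfer to the real line -/

theorem mainTheorem4 (P : ℤ[X]) (hP : 2 ≤ P.natDegree) :
    (∀ (s : ℝ) (m : ℕ), 0 < s → s ≤ 1 → 1 ≤ m →
      ∀ᵐ α : ℝ ∂volume,
        {p : ℕ × ℤ | 1 ≤ p.1 ∧
          |α - (p.2 : ℝ) / (p.1 : ℝ) ^ P.natDegree| <
            1 / (p.1 : ℝ) ^ ((P.natDegree : ℝ) + s) ∧
          (p.2 : ZMod p.1) ∈
            residueDilate (negLeadingCoeff P) (primitivePowerResidues P.natDegree p.1) ∧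
          Int.gcd (p.1 : ℤ) ((P.natDegree : ℤ) * negLeadingCoeff P) = 1 ∧
          ArithmeticFunction.cardDistinctFactors p.1 ≤ m}.Infinite) ∧
    (∀ τ : ℝ, τ ≤ (P.natDegree : ℝ) + 1 →
      volume (ITilde P τ) = 1 ∧ volume (IStar P τ) = 1) := by
  set d := P.natDegree with hd
  set a := negLeadingCoeff P with ha
  have ha0 : a ≠ 0 := by
    rw [ha, negLeadingCoeff, neg_ne_zero, leadingCoeff_ne_zero]
    intro h0
    rw [hd, h0, natDegree_zero] at hP
    omega
  have key : ∀ τ : ℝ, τ ≤ (d : ℝ) + 1 → ∀ᵐ α : ℝ,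
      {p : ℕ × ℤ | 1 ≤ p.1 ∧ |α - (p.2 : ℝ) / (p.1 : ℝ) ^ d| < 1 / (p.1 : ℝ) ^ τ ∧
        (p.2 : ZMod p.1) ∈ residueDilate a (primitivePowerResidues d p.1) ∧
        Int.gcd (p.1 : ℤ) ((d : ℤ) * a) = 1 ∧
        ArithmeticFunction.cardDistinctFactors p.1 ≤ 1}.Infinite := by
    intro τ hτ
    -- The factor `2` makes doubling invertible modulo `p`; the factor `d * a` gives the gcd
    -- condition and `a ≠ 0` modulo `p`.
    set K : ℕ := 2 * (d * a.natAbs) with hKdef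
    have hK : K ≠ 0 := by
      have := Int.natAbs_ne_zero.2 ha0
      have : d ≠ 0 := by omega
      positivity
    have haK : a ∣ (K : ℤ) := by
      rw [hKdef]
      push_cast
      exact Dvd.dvd.mul_left (Dvd.dvd.mul_left ((dvd_abs a a).2 dvd_rfl) _) _
    have hae := UnitAddCircle.ae_coe_of_ae
      (ae_frequently_mem_thickening_primitivePowerFractions (d := d) (by omega) a hK
        (dvd_mul_right 2 _) haK)
    filter_upwards [hae] with α hα
    refine Set.Infinite.of_image Prod.fst ?_
    refine (Nat.frequently_atTop_iff_infinite.1 hα).mono ?_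
    rintro p ⟨⟨hp, hpK⟩, hx⟩
    obtain ⟨_, ⟨b, hb, rfl⟩, hdist⟩ := mem_thickening_iff.1 hx
    rw [dist_eq_norm, ← AddCircle.coe_sub, UnitAddCircle.norm_eq] at hdist
    set n := round (α - (b : ℝ) / (p : ℝ) ^ d)
    have hp1 : (1 : ℝ) ≤ p := by exact_mod_cast hp.one_le
    have hp0 : (p : ℝ) ^ d ≠ 0 := by positivity
    -- Shifting `b` by `n * p ^ d` turns circle distance into real distance and preserves `b` modulo
    -- `p`, since `d ≠ 0`.
    refine ⟨(p, b + n * p ^ d), ⟨hp.one_le, ?_, ?_, ?_, ?_⟩, rfl⟩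
    · have h1 : α - ((b + n * p ^ d : ℤ) : ℝ) / (p : ℝ) ^ d = α - (b : ℝ) / (p : ℝ) ^ d - n := by
        push_cast
        field_simp
        ring
      have h2 : (p : ℝ) ^ τ ≤ (p : ℝ) ^ (d + 1) := by
        rw [← Real.rpow_natCast]
        exact Real.rpow_le_rpow_of_exponent_le hp1 (by exact_mod_cast hτ)
      rw [h1]
      exact hdist.trans_le (one_div_le_one_div_of_le (by positivity) h2)
    · have h1 : ((b + n * p ^ d : ℤ) : ZMod p) = b := by
        have : d ≠ 0 := by omega
        simp [this]
      rw [h1]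
      exact hb
    · rw [Int.gcd_eq_natAbs, Int.natAbs_mul, Int.natAbs_natCast, Int.natAbs_natCast]
      exact (hp.coprime_iff_not_dvd).2 fun h => hpK (h.mul_left 2)
    · exact (ArithmeticFunction.cardDistinctFactors_apply_prime hp).le
  refine ⟨fun s m _ hs hm => ?_, fun τ hτ => ?_⟩
  · filter_upwards [key (d + s) (by linarith)] with α hα
    refine hα.mono ?_
    rintro p ⟨h1, h2, h3, h4, h5⟩
    exact ⟨h1, h2, h3, h4, h5.trans hm⟩
  · have hI : ITilde P τ ⊆ IStar P τ := by
      rintro α ⟨h1, h2⟩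
      refine ⟨h1, h2.mono ?_⟩
      rintro p ⟨g1, g2, ⟨x, ⟨y, _, hy⟩, hx⟩, _⟩
      exact ⟨g1, g2, x, ⟨y, hy⟩, hx⟩
    have hvol : volume (Set.Ioo (0 : ℝ) 1) = 1 := by simp
    have hle : volume (IStar P τ) ≤ 1 := hvol ▸ measure_mono fun α h => h.1
    have hge : 1 ≤ volume (ITilde P τ) := by
      rw [← hvol]
      refine measure_mono_ae ?_
      filter_upwards [key τ hτ] with α hα hα01
      refine ⟨hα01, hα.mono ?_⟩
      rintro p ⟨h1, h2, h3, h4, _⟩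
      exact ⟨h1, h2, h3, h4⟩
    exact ⟨le_antisymm ((measure_mono hI).trans hle) hge,
      le_antisymm hle (hge.trans (measure_mono hI))⟩
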